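/- Consider a source and a fully connected network of $n\ge 1$ nodes. The source state $Q(t)\in\{1,\dots,M\}$, $M\ge 2$, is an irreducible continuous-time Markov chain with generator $(q_{ij})$. Each node $i$ stores a content $S_i(t)\in\{1,\dots,M\}$ and has a version age $X_i(t)\in\{0,1,2,\dots\}$, and the state changes at the following events, driven by independent Poisson clocks. (i) Whenever the source changes state, every $X_i$ increases by $1$ and the contents stay the same. (ii) The source sends its state to each node $j$ at rate $\lambda_s/n$, which sets $X_j=0$ and $S_j=Q$. (iii) For each ordered pair $i\ne j$, node $i$ sends its packet to node $j$ at rate $\lambda/(n-1)$, and $j$ adopts it, with its version age, if and only if $X_i<X_j$. Here $\lambda\ge 0$ is fixed and $\lambda_s>0$. Initially (almost surely) nodes of age $0$ hold the current source state and nodes of equal age hold equal contents. For a set $A$ of $k$ nodes put $X_A=\min_{j\in A}X_j$ and $C_A=\frac1k\#\{j\in A: S_j=Q\}$. For every $k\in\{1,\dots,n\}$, $m\in\{1,\dots,M\}$ and $\lambda_s>0$ the limits $$g_k^{(m)}=\lim_{t\to\infty}\mathbb P\bigl(Q(t)=m,\ X_A(t)=0\bigr),\qquad c_k^{(m)}=\lim_{t\to\infty}\mathbb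 E\bigl[C_A(t)\mathbf 1_{\{Q(t)=m\}}\bigr]$$ exist and depend neither on the initial law nor on the choice of the set $A$ with $|A|=k$. With $G_k=\sum_{m=1}^M c_k^{(m)}g_k^{(m)}$, $$\lim_{\lambda_s\to0^+}g_k^{(m)}=0\quad\text{for all }k,m,\qquad \lim_{\lambda_s\to0^+}G_k=0\quad\text{for all }k.$$ Moreover the steady-state probability that $X_A=0$ and the freshest node of $A$ is accurate (that is, some $j\in A$ has $X_j=X_A=0$ and $S_j=Q$), and the steady-state expected fraction $\lim_{t\to\infty}\mathbb E\bigl[\frac1k\#\{j\in A: X_j(t)=0,\ S_j(t)=Q(t)\}\bigr]$ of fresh and accurate nodes of $A$, exist, depend on $A$ only through $k$, and tend to $0$ as $\lambda_s\to0^+$. -/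

import Mathlib

open Filter Topology MeasureTheory ProbabilityTheory

/-- `q` is the generator of an irreducible continuous-time Markov chain on `Fin M`:
off-diagonal entries are the (nonnegative) transition rates, rows sum to zero, and every state
can be reached from every other one through transitions of positive rate. -/
structure IsIrreducibleGenerator {M : ℕ} (q : Matrix (Fin M) (Fin M) ℝ) : Prop where
  rate_nonneg : ∀ i j, i ≠ j → 0 ≤ q i j
  row_sum : ∀ i, ∑ j, q i j = 0
  irreducible : ∀ i j, Relation.ReflTransGen (fun a b => a ≠ b ∧ 0 < q a b) i j

/-- State of the network: the source state `Q`, the version ages `X_i` of the nodes, and the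
contents `S_i` of the nodes. -/
structure NetState (n M : ℕ) where
  src : Fin M
  age : Fin n → ℕ
  content : Fin n → Fin M

namespace NetState

variable {n M : ℕ}

instance : MeasurableSpace (NetState n M) := ⊤

instance : DiscreteMeasurableSpace (NetState n M) := ⟨fun _ => trivial⟩

/-- States in which the stored packets are versions of the source's update: a node of version age
zero holds the current source state, and nodes holding the same version hold the same content. -/
def Consistent (x : NetState n M) : Prop :=
  (∀ i, x.age i = 0 → x.content i = x.src) ∧
    ∀ i j, x.age i = x.age j → x.content i = x.content j

/-- The source moves from `a` to `b`, when it is in state `a`: a new version is generated, so all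
version ages increase by one. Nothing happens when the source is not in state `a`. -/
def sourceMove (a b : Fin M) (x : NetState n M) : NetState n M :=
  if x.src = a then { src := b, age := fun i => x.age i + 1, content := x.content } else x

/-- The source sends its current state to node `j`. -/
def push (j : Fin n) (x : NetState n M) : NetState n M where
  src := x.src
  age := Function.update x.age j 0
  content := Function.update x.content j x.src

/-- Node `i` sends its packet to node `j`, which keeps it only if it is fresher. -/
def gossip (i j : Fin n) (x : NetState n M) : NetState n M where
  src := x.src
  age := Function.update x.age j (min (x.age i) (x.age j))
  content := Function.update x.content j
    (if x.age i < x.age j then x.content i else x.content j)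

/-- The version age `X_A = min_{j ∈ A} X_j` of a (nonempty) set `A` of nodes. -/
noncomputable def setAge (x : NetState n M) (A : Finset (Fin n)) : ℕ :=
  sInf (x.age '' (A : Set (Fin n)))

/-- The accuracy indicator `C_i`. -/
def acc (x : NetState n M) (i : Fin n) : ℝ :=
  if x.content i = x.src then 1 else 0

/-- The average accuracy `C_A` of a set `A` of nodes. -/
noncomputable def setAcc (x : NetState n M) (A : Finset (Fin n)) : ℝ :=
  (∑ i ∈ A, x.acc i) / A.card

/-- The fraction of the nodes of `A` which are fresh (version age zero) and accurate. -/
noncomputable def freshAccFraction (x : NetState n M) (A : Finset (Fin n)) : ℝ :=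
  (∑ i ∈ A, if x.age i = 0 then x.acc i else 0) / A.card

end NetState

/-- The events that drive the network: `inl (a, b)` is a move of the source from `a` to `b`,
`inr (inl j)` is a push from the source to node `j`, and `inr (inr (i, j))` is a gossip packet
sent by node `i` to node `j`. -/
abbrev NetEvent (n M : ℕ) : Type := (Fin M × Fin M) ⊕ (Fin n ⊕ (Fin n × Fin n))

namespace NetEvent

variable {n M : ℕ}

/-- The reset map of an event. -/
def apply : NetEvent n M → NetState n M → NetState n M
  | .inl (a, b) => NetState.sourceMove a b
  | .inr (.inl j) => NetState.push j
  | .inr (.inr (i, j)) => NetState.gossip i j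

/-- The rate of the Poisson clock of each event: `q a b` for a move of the source from `a` to
`b ≠ a` (effective only while the source is in state `a`), `ls / n` for a push to a given node,
and `lam / (n - 1)` for gossip along a given ordered pair of distinct nodes. -/
noncomputable def rate (q : Matrix (Fin M) (Fin M) ℝ) (lam ls : ℝ) : NetEvent n M → ℝ
  | .inl (a, b) => if a = b then 0 else q a b
  | .inr (.inl _) => ls / n
  | .inr (.inr (i, j)) => if i = j then 0 else lam / ((n : ℝ) - 1)

theorem tsum_rate_ne_zero [NeZero n] (q : Matrix (Fin M) (Fin M) ℝ) (lam : ℝ) {ls : ℝ}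
    (hs : 0 < ls) :
    (∑' e : NetEvent n M, ENNReal.ofReal (rate q lam ls e)) ≠ 0 := by
  intro h
  have h0 := (ENNReal.tsum_eq_zero.1 h) (.inr (.inl (0 : Fin n)))
  have hn : (0 : ℝ) < n := by exact_mod_cast Nat.pos_of_ne_zero (NeZero.ne n)
  rw [ENNReal.ofReal_eq_zero] at h0
  exact absurd (div_pos hs hn) (not_lt.2 h0)

theorem tsum_rate_ne_top (q : Matrix (Fin M) (Fin M) ℝ) (lam ls : ℝ) :
    (∑' e : NetEvent n M, ENNReal.ofReal (rate q lam ls e)) ≠ ⊤ := by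
  rw [tsum_fintype]
  exact ENNReal.sum_ne_top.2 fun e _ => ENNReal.ofReal_ne_top

/-- The type of the next event to occur: among independent Poisson clocks, the next one to ring
is clock `e` with probability proportional to the rate of `e`. -/
noncomputable def law [NeZero n] (q : Matrix (Fin M) (Fin M) ℝ) (lam : ℝ) {ls : ℝ}
    (hs : 0 < ls) : PMF (NetEvent n M) :=
  PMF.normalize (fun e => ENNReal.ofReal (rate q lam ls e))
    (tsum_rate_ne_zero q lam hs) (tsum_rate_ne_top q lam ls)

end NetEvent

section Law

variable {n M : ℕ} [NeZero n]

/-- The law of the network state after `N` events, when its initial law is `init`. -/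
noncomputable def lawAfter (q : Matrix (Fin M) (Fin M) ℝ) (lam : ℝ) {ls : ℝ} (hs : 0 < ls)
    (init : PMF (NetState n M)) : ℕ → PMF (NetState n M)
  | 0 => init
  | N + 1 => (lawAfter q lam hs init N).bind fun x =>
      (NetEvent.law q lam hs).map fun e => e.apply x

/-- The law of the network state at time `t ≥ 0`. The superposition of the independent Poisson
clocks is a Poisson process whose rate is the sum of their rates, and the types of the successive
events are independent of it and of each other. -/
noncomputable def lawAt (q : Matrix (Fin M) (Fin M) ℝ) (lam : ℝ) {ls : ℝ} (hs : 0 < ls)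
    (init : PMF (NetState n M)) (t : ℝ) : PMF (NetState n M) :=
  (poissonMeasure
    (Real.toNNReal (t * ∑ e : NetEvent n M, NetEvent.rate q lam ls e))).toPMF.bind
      (lawAfter q lam hs init)

/-- `v` is the steady-state mean of the observable `f`: from every initial law carried by
consistent states, `E[f(state at time t)] → v` as `t → ∞`. -/
def IsSteadyStateMean (q : Matrix (Fin M) (Fin M) ℝ) (lam : ℝ) {ls : ℝ} (hs : 0 < ls)
    (f : NetState n M → ℝ) (v : ℝ) : Prop :=
  ∀ init : PMF (NetState n M), (∀ x ∈ init.support, x.Consistent) →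
    Tendsto (fun t : ℝ => ∫ x, f x ∂(lawAt q lam hs init t).toMeasure) atTop (𝓝 v)

end Law

/-! The state at time `t` is obtained by applying a Poisson number of independent events, with mean
`t` times the total rate `Λ`. So everything reduces to the embedded chain, whose Markov operator `T`
averages an observable over the finitely many reset maps.

Existence of the limits is Doeblin's argument. By irreducibility some word of positive-rate source
moves brings every source state to one fixed state; following it by a push to every node sends every
network state to the same state. This word has positive probability, so it contracts the oscillation
of bounded observables by a fixed factor. Hence `T^[N] f` converges to a constant, uniformly in the
starting state (`exists_avgStep_iterate_tendsto`), and the Poisson mixture inherits the limit as its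
mean grows. Since the rates are invariant under renaming nodes, the limit depends on the set of
nodes only through its size.

For the vanishing, let `h` indicate that some node has age zero. Pushes create freshness at total
rate at most `ls`, gossip never creates it, and every source move destroys it, at rate at least some
`ρ > 0` determined by `q` alone. This drift bounds by `ls / ρ` the steady-state mean of every
observable dominated by `h` (`le_of_le_someFresh`). For `G_k` it suffices to add that `0 ≤ c ≤ 1`.
-/

/-! ### Markov operators given by finitely many random maps: contraction and drift. -/

section AvgStep

variable {E S : Type*} [Fintype E]

/-- One step of the Markov operator which applies the random map `act e` with probability `w e`. -/
def avgStep (w : E → ℝ) (act : E → S → S) (f : S → ℝ) (x : S) : ℝ :=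
  ∑ e, w e * f (act e x)

variable {w : E → ℝ} {act : E → S → S}

theorem avgStep_mono (hw : ∀ e, 0 ≤ w e) {f g : S → ℝ} (h : ∀ x, f x ≤ g x) (x : S) :
    avgStep w act f x ≤ avgStep w act g x :=
  Finset.sum_le_sum fun e _ => mul_le_mul_of_nonneg_left (h _) (hw e)

theorem avgStep_affine (hw1 : ∑ e, w e = 1) (a b : ℝ) (f : S → ℝ) (x : S) :
    avgStep w act (fun y => a + b * f y) x = a + b * avgStep w act f x := by
  simp only [avgStep, mul_add, Finset.sum_add_distrib, Finset.mul_sum, ← Finset.sum_mul, hw1,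
    one_mul]
  congr 1
  exact Finset.sum_congr rfl fun e _ => by ring

theorem avgStep_const (hw1 : ∑ e, w e = 1) (a : ℝ) (x : S) :
    avgStep w act (fun _ => a) x = a := by
  simp [avgStep, ← Finset.sum_mul, hw1]

theorem avgStep_iterate_mono (hw : ∀ e, 0 ≤ w e) {f g : S → ℝ} (h : ∀ x, f x ≤ g x) (N : ℕ) :
    ∀ x, (avgStep w act)^[N] f x ≤ (avgStep w act)^[N] g x := by
  induction N with
  | zero => exact h
  | succ N ih =>
    intro x
    rw [Function.iterate_succ_apply', Function.iterate_succ_apply']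
    exact avgStep_mono hw ih x

/-- Slope `-1` turns upper bounds into lower bounds, and slope `0` handles constants. -/
theorem avgStep_iterate_affine (hw1 : ∑ e, w e = 1) (a b : ℝ) (f : S → ℝ) (N : ℕ) :
    (avgStep w act)^[N] (fun y => a + b * f y) = fun x => a + b * (avgStep w act)^[N] f x := by
  induction N with
  | zero => rfl
  | succ N ih =>
    rw [Function.iterate_succ_apply', ih, Function.iterate_succ_apply']
    funext x
    exact avgStep_affine hw1 a b _ x

theorem avgStep_iterate_mem_Icc (hw : ∀ e, 0 ≤ w e) (hw1 : ∑ e, w e = 1) {f : S → ℝ} {a b : ℝ}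
    (h : ∀ x, f x ∈ Set.Icc a b) (N : ℕ) : ∀ x, (avgStep w act)^[N] f x ∈ Set.Icc a b := by
  induction N with
  | zero => exact h
  | succ N ih =>
    intro x
    rw [Function.iterate_succ_apply']
    refine ⟨?_, ?_⟩
    · rw [← avgStep_const (act := act) hw1 a x]
      exact avgStep_mono hw (fun y => (ih y).1) x
    · rw [← avgStep_const (act := act) hw1 b x]
      exact avgStep_mono hw (fun y => (ih y).2) x

/-- Following a given word of events has at least the probability of that word. -/
theorem avgStep_iterate_le_of_word (hw : ∀ e, 0 ≤ w e) (hw1 : ∑ e, w e = 1) {f : S → ℝ} {b : ℝ}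
    (h : ∀ x, f x ≤ b) (W : List E) : ∀ x, (avgStep w act)^[W.length] f x ≤
      (1 - (W.map w).prod) * b + (W.map w).prod * f (W.foldl (fun y e => act e y) x) := by
  classical
  induction W with
  | nil => intro x; simp
  | cons e W ih =>
    intro x
    have hb : ∀ y, (avgStep w act)^[W.length] f y ≤ b := fun y => by
      -- The constant `b` is written with slope zero so that the affine rule evaluates its iterates.
      refine (avgStep_iterate_mono hw (g := fun _ => b + 0 * f y) (by simpa using h) _ y).trans ?_
      rw [avgStep_iterate_affine hw1 b 0 (fun _ => f y)]
      simp
    rw [List.length_cons, Function.iterate_succ_apply', avgStep,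
      ← Finset.add_sum_erase _ _ (Finset.mem_univ e)]
    -- Events other than the first letter have total weight `1 - w e`, and there the bound `b`
    -- suffices.
    have h1 : ∑ e' ∈ Finset.univ.erase e, w e' * (avgStep w act)^[W.length] f (act e' x) ≤
        (1 - w e) * b := by
      rw [← hw1, ← Finset.add_sum_erase _ _ (Finset.mem_univ e), add_sub_cancel_left,
        Finset.sum_mul]
      exact Finset.sum_le_sum fun e' _ => mul_le_mul_of_nonneg_left (hb _) (hw e')
    have h2 := mul_le_mul_of_nonneg_left (ih (act e x)) (hw e)
    simp only [List.map_cons, List.prod_cons, List.foldl_cons]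
    linarith

/-- **Doeblin's theorem**: if some word of events of positive probability resets the state, then
the iterates of the Markov operator converge uniformly to a constant. -/
theorem exists_avgStep_iterate_tendsto (hw : ∀ e, 0 ≤ w e) (hw1 : ∑ e, w e = 1) {W : List E}
    (hW : ∀ e ∈ W, 0 < w e) {x₀ : S} (hreset : ∀ x, W.foldl (fun y e => act e y) x = x₀)
    {f : S → ℝ} (hf : ∀ x, f x ∈ Set.Icc (0 : ℝ) 1) :
    ∃ v, ∀ ε > 0, ∃ N₀, ∀ N ≥ N₀, ∀ x, |(avgStep w act)^[N] f x - v| ≤ ε := by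
  set T := avgStep w act with hT
  set δ := (W.map w).prod with hδ
  have hδ0 : 0 < δ := List.prod_pos (by simpa using hW)
  have hδ1 : δ ≤ 1 := by
    have hle : ∀ e, w e ≤ 1 := fun e => hw1 ▸
      Finset.single_le_sum (fun e _ => hw e) (Finset.mem_univ e)
    rw [hδ]
    clear hreset hW hδ hδ0
    induction W with
    | nil => simp
    | cons e W ih =>
      simpa using mul_le_one₀ (hle e) (List.prod_nonneg (by simpa using fun e _ => hw e)) ih
  -- With weight `δ` the word is followed and contributes `g x₀`, whatever the start. Only the
  -- remaining `1 - δ` depends on `x`, so the length of the range interval shrinks by `1 - δ`. The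
  -- lower bound is the upper bound for `-g`.
  have contract : ∀ (g : S → ℝ) (a b : ℝ), (∀ x, g x ∈ Set.Icc a b) → ∀ x,
      T^[W.length] g x ∈ Set.Icc ((1 - δ) * a + δ * g x₀) ((1 - δ) * b + δ * g x₀) := by
    intro g a b hg x
    refine ⟨?_, ?_⟩
    · have h := avgStep_iterate_le_of_word (act := act) hw hw1 (f := fun y => 0 + (-1) * g y)
        (b := -a) (fun y => by linarith [(hg y).1]) W x
      rw [avgStep_iterate_affine hw1, hreset, ← hδ, ← hT] at h
      simp only at h
      linarith
    · have h := avgStep_iterate_le_of_word (act := act) hw hw1 (f := g) (fun y => (hg y).2) W x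
      rwa [hreset] at h
  -- One interval serves all later `N`, because averaging never leaves an interval.
  have main : ∀ j : ℕ, ∃ a, ∀ N ≥ j * W.length, ∀ x,
      T^[N] f x ∈ Set.Icc a (a + (1 - δ) ^ j) := by
    intro j
    induction j with
    | zero =>
      exact ⟨0, fun N _ x => by simpa using avgStep_iterate_mem_Icc hw hw1 hf N x⟩
    | succ j ih =>
      obtain ⟨a, ha⟩ := ih
      refine ⟨(1 - δ) * a + δ * T^[j * W.length] f x₀, fun N hN x => ?_⟩
      have h1 := contract _ _ _ (ha (j * W.length) le_rfl)
      obtain ⟨r, rfl⟩ := Nat.exists_eq_add_of_le hN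
      have h2 := avgStep_iterate_mem_Icc (act := act) hw hw1 h1 r x
      rw [← hT, ← Function.iterate_add_apply, ← Function.iterate_add_apply] at h2
      have e : r + W.length + j * W.length = (j + 1) * W.length + r := by ring
      rw [e] at h2
      convert! h2 using 2
      ring
  have hlim : Tendsto (fun j : ℕ => (1 - δ) ^ j) atTop (𝓝 0) :=
    tendsto_pow_atTop_nhds_zero_of_lt_one (by linarith) (by linarith)
  have hcauchy : CauchySeq fun N => T^[N] f x₀ := by
    rw [Metric.cauchySeq_iff']
    intro ε hε
    obtain ⟨j, hj⟩ := (hlim.eventually (gt_mem_nhds hε)).exists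
    obtain ⟨a, ha⟩ := main j
    refine ⟨j * W.length, fun N hN => ?_⟩
    have h1 := ha N hN x₀
    have h2 := ha _ le_rfl x₀
    rw [Real.dist_eq, abs_lt]
    constructor <;> linarith [h1.1, h1.2, h2.1, h2.2]
  obtain ⟨v, hv⟩ := cauchySeq_tendsto_of_complete hcauchy
  refine ⟨v, fun ε hε => ?_⟩
  obtain ⟨j, hj⟩ := (hlim.eventually (gt_mem_nhds hε)).exists
  obtain ⟨a, ha⟩ := main j
  -- The limit along `x₀` lies in the same short interval as all late iterates at all points, which
  -- makes the convergence uniform.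
  have hva : v ∈ Set.Icc a (a + (1 - δ) ^ j) := isClosed_Icc.mem_of_tendsto hv
    (eventually_atTop.2 ⟨j * W.length, fun N hN => ha N hN x₀⟩)
  refine ⟨j * W.length, fun N hN x => ?_⟩
  have h1 := ha N hN x
  rw [abs_le]
  constructor <;> linarith [h1.1, h1.2, hva.1, hva.2]

/-- A drift inequality towards `{h = 0}` bounds the iterates at points where `h` vanishes. -/
theorem avgStep_iterate_le_of_drift (hw : ∀ e, 0 ≤ w e) (hw1 : ∑ e, w e = 1) {h : S → ℝ}
    {K β : ℝ} (hβ : 0 ≤ β) (hd : ∀ x, avgStep w act h x ≤ K * (1 - β) + β * h x) (N : ℕ) :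
    ∀ x, (avgStep w act)^[N] h x ≤ K * (1 - β ^ N) + β ^ N * h x := by
  induction N with
  | zero => intro x; simp
  | succ N ih =>
    intro x
    rw [Function.iterate_succ_apply']
    -- The hypothesis says that `h - K` is mapped below `β * (h - K)`; this is iterated.
    refine (avgStep_mono hw ih x).trans ?_
    rw [avgStep_affine hw1]
    have := mul_le_mul_of_nonneg_left (hd x) (pow_nonneg hβ N)
    rw [pow_succ]
    linarith

end AvgStep

/-! ### Integrals against discrete mixtures and Poisson mixtures. -/

section Integral

theorem PMF.toMeasure_bind_eq_sum {α β : Type*} [MeasurableSpace β] (p : PMF α) (κ : α → PMF β) :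
    (p.bind κ).toMeasure = Measure.sum fun a => p a • (κ a).toMeasure := by
  ext s hs
  rw [PMF.toMeasure_bind_apply _ _ _ hs, Measure.sum_apply _ hs]
  simp

theorem PMF.integrable_of_mem_Icc {β : Type*} [MeasurableSpace β] [DiscreteMeasurableSpace β]
    (p : PMF β) {f : β → ℝ} {a b : ℝ} (hf : ∀ x, f x ∈ Set.Icc a b) : Integrable f p.toMeasure :=
  Integrable.of_mem_Icc a b (Measurable.of_discrete.aemeasurable) (Eventually.of_forall hf)

theorem PMF.integral_mem_Icc {β : Type*} [MeasurableSpace β] [DiscreteMeasurableSpace β]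
    (p : PMF β) {f : β → ℝ} {a b : ℝ} (hf : ∀ x, f x ∈ Set.Icc a b) :
    ∫ x, f x ∂p.toMeasure ∈ Set.Icc a b := by
  have hi := p.integrable_of_mem_Icc hf
  refine ⟨?_, ?_⟩
  · simpa using integral_mono (integrable_const a) hi fun x => (hf x).1
  · simpa using integral_mono hi (integrable_const b) fun x => (hf x).2

theorem PMF.integral_bind {α β : Type*} [MeasurableSpace α] [DiscreteMeasurableSpace α]
    [MeasurableSpace β] [DiscreteMeasurableSpace β] (p : PMF α) (κ : α → PMF β) {f : β → ℝ}
    {a b : ℝ} (hf : ∀ x, f x ∈ Set.Icc a b) :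
    ∫ x, f x ∂(p.bind κ).toMeasure = ∫ y, ∫ x, f x ∂(κ y).toMeasure ∂p.toMeasure := by
  have hi := (p.bind κ).integrable_of_mem_Icc hf
  rw [PMF.integral_eq_tsum p _ (p.integrable_of_mem_Icc fun y => (κ y).integral_mem_Icc hf)]
  rw [PMF.toMeasure_bind_eq_sum] at hi ⊢
  rw [integral_sum_measure hi]
  simp [integral_smul_measure]

/-- Poisson mixtures of a convergent sequence converge as the mean grows. -/
theorem tendsto_integral_poissonMeasure {u : ℕ → ℝ} (hu : ∀ N, u N ∈ Set.Icc (0 : ℝ) 1) {v : ℝ}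
    (hv : Tendsto u atTop (𝓝 v)) :
    Tendsto (fun r : NNReal => ∫ N, u N ∂poissonMeasure r) atTop (𝓝 v) := by
  have hv01 : v ∈ Set.Icc (0 : ℝ) 1 := isClosed_Icc.mem_of_tendsto hv (Eventually.of_forall hu)
  -- Each fixed count has mass `r ^ j * exp (-r) / j!`, which vanishes as `r` grows; hence so does
  -- the mass below `N₀`.
  have hmass : ∀ j : ℕ, Tendsto (fun r : NNReal => (poissonMeasure r).real {j}) atTop (𝓝 0) := by
    intro j
    have h := ((Real.tendsto_pow_mul_exp_neg_atTop_nhds_zero j).comp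
      (NNReal.tendsto_coe_atTop.2 tendsto_id)).div_const (j.factorial : ℝ)
    simp only [zero_div] at h
    refine h.congr fun r => ?_
    rw [poissonMeasure_real_singleton]
    simp [mul_comm]
  rw [Metric.tendsto_atTop] at hv
  rw [Metric.tendsto_nhds]
  intro ε hε
  obtain ⟨N₀, hN₀⟩ := hv (ε / 2) (half_pos hε)
  have hsum : Tendsto (fun r : NNReal => ∑ j ∈ Finset.range N₀, (poissonMeasure r).real {j}) atTop
      (𝓝 0) := by
    simpa using tendsto_finsetSum (Finset.range N₀) fun j _ => hmass j
  filter_upwards [hsum.eventually (gt_mem_nhds (half_pos hε))] with r hr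
  have hiu : Integrable u (poissonMeasure r) :=
    Integrable.of_mem_Icc 0 1 Measurable.of_discrete.aemeasurable (Eventually.of_forall hu)
  have hS : MeasurableSet ((Finset.range N₀ : Finset ℕ) : Set ℕ) := .of_discrete
  -- Below `N₀` the trivial bound `1` is used, as both numbers lie in the unit interval.
  have hbound : ∀ N, |u N - v| ≤
      ε / 2 + ((Finset.range N₀ : Finset ℕ) : Set ℕ).indicator (fun _ => (1 : ℝ)) N := by
    intro N
    by_cases hN : N < N₀
    · rw [Set.indicator_of_mem (by simpa using hN)]
      have : |u N - v| ≤ 1 := by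
        rw [abs_le]; constructor <;> linarith [(hu N).1, (hu N).2, hv01.1, hv01.2]
      linarith
    · rw [Set.indicator_of_notMem (by simpa using hN), add_zero]
      exact (hN₀ N (not_lt.1 hN)).le
  have hind : Integrable (((Finset.range N₀ : Finset ℕ) : Set ℕ).indicator fun _ => (1 : ℝ))
      (poissonMeasure r) := (integrable_const 1).indicator hS
  have hle := integral_mono (hiu.sub (integrable_const v)).abs
    ((integrable_const (ε / 2)).add hind) hbound
  rw [integral_add' (integrable_const _) hind, integral_indicator_const _ hS] at hle
  rw [sum_measureReal_singleton] at hr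
  have heq : ∫ N, u N ∂poissonMeasure r - v = ∫ N, (u N - v) ∂poissonMeasure r := by
    rw [integral_sub hiu (integrable_const v)]; simp
  rw [Real.dist_eq, heq]
  refine abs_integral_le_integral_abs.trans_lt (hle.trans_lt ?_)
  simp at hr ⊢
  linarith

end Integral

/-! ### Event probabilities of the embedded chain. -/

namespace NetEvent

variable {n M : ℕ} {q : Matrix (Fin M) (Fin M) ℝ} {lam ls : ℝ}

theorem rate_nonneg [NeZero n] (hq : IsIrreducibleGenerator q) (hlam : 0 ≤ lam) (hs : 0 < ls)
    (e : NetEvent n M) : 0 ≤ rate q lam ls e := by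
  have hn : (1 : ℝ) ≤ n := by exact_mod_cast Nat.one_le_iff_ne_zero.2 (NeZero.ne n)
  rcases e with ⟨a, b⟩ | j | ⟨i, j⟩
  · simp only [rate]
    split_ifs with h
    exacts [le_rfl, hq.rate_nonneg a b h]
  · simp only [rate]
    positivity
  · simp only [rate]
    split_ifs with h
    exacts [le_rfl, div_nonneg hlam (by linarith)]

theorem sum_rate_pos [NeZero n] (hq : IsIrreducibleGenerator q) (hlam : 0 ≤ lam) (hs : 0 < ls) :
    0 < ∑ e : NetEvent n M, rate q lam ls e := by
  have hn : (0 : ℝ) < n := by exact_mod_cast Nat.pos_of_ne_zero (NeZero.ne n)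
  have h : rate q lam ls (.inr (.inl 0) : NetEvent n M) ≤ _ := Finset.single_le_sum
    (fun e _ => rate_nonneg hq hlam hs e) (Finset.mem_univ _)
  exact (div_pos hs hn).trans_le h

/-- The probability that the next event is `e`. -/
noncomputable def prob (q : Matrix (Fin M) (Fin M) ℝ) (lam ls : ℝ) (e : NetEvent n M) : ℝ :=
  rate q lam ls e / ∑ e' : NetEvent n M, rate q lam ls e'

theorem law_toReal [NeZero n] (hq : IsIrreducibleGenerator q) (hlam : 0 ≤ lam) (hs : 0 < ls)
    (e : NetEvent n M) : (law q lam hs e).toReal = prob q lam ls e := by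
  rw [law, PMF.normalize_apply, tsum_fintype,
    ← ENNReal.ofReal_sum_of_nonneg fun e _ => rate_nonneg hq hlam hs e, ENNReal.toReal_mul,
    ENNReal.toReal_inv, ENNReal.toReal_ofReal (rate_nonneg hq hlam hs e),
    ENNReal.toReal_ofReal (sum_rate_pos hq hlam hs).le, prob, div_eq_mul_inv]

theorem prob_nonneg [NeZero n] (hq : IsIrreducibleGenerator q) (hlam : 0 ≤ lam) (hs : 0 < ls)
    (e : NetEvent n M) : 0 ≤ prob q lam ls e :=
  div_nonneg (rate_nonneg hq hlam hs e) (sum_rate_pos hq hlam hs).le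

theorem sum_prob [NeZero n] (hq : IsIrreducibleGenerator q) (hlam : 0 ≤ lam) (hs : 0 < ls) :
    ∑ e : NetEvent n M, prob q lam ls e = 1 := by
  simp only [prob, ← Finset.sum_div]
  exact div_self (sum_rate_pos hq hlam hs).ne'

end NetEvent

/-! ### Synchronizing words for the source. -/

section Synchronization

variable {M : ℕ}

/-- The effect on the source state of a word of source moves. -/
def srcAfter (W : List (Fin M × Fin M)) (a : Fin M) : Fin M :=
  W.foldl (fun s p => if s = p.1 then p.2 else s) a

theorem srcAfter_append (W W' : List (Fin M × Fin M)) (a : Fin M) :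
    srcAfter (W ++ W') a = srcAfter W' (srcAfter W a) :=
  List.foldl_append

/-- The word spells a path from `a` to `m`. That it also returns `m` to itself is what allows such
words to be concatenated without disturbing the states already brought to `m`. -/
theorem exists_word_of_reflTransGen {r : Fin M → Fin M → Prop} {a m : Fin M}
    (h : Relation.ReflTransGen r a m) :
    ∃ W : List (Fin M × Fin M), (∀ p ∈ W, r p.1 p.2) ∧ srcAfter W a = m ∧ srcAfter W m = m := by
  induction h using Relation.ReflTransGen.head_induction_on with
  | refl => exact ⟨[], by simp, rfl, rfl⟩
  | @head a b hab _ ih =>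
    obtain ⟨W, hW, hb, hm⟩ := ih
    refine ⟨(a, b) :: W, ?_, ?_, ?_⟩
    · simpa using ⟨hab, fun c d => hW (c, d)⟩
    · simpa [srcAfter] using hb
    -- If `m = a`, the new first move takes `m` to `b`, and `W` brings it back; otherwise that move
    -- ignores `m`.
    · by_cases hma : m = a
      · simpa [srcAfter, hma] using hb.trans hma
      · simpa [srcAfter, hma] using hm

/-- A word of positive-rate source moves that brings every source state to `m`. -/
theorem exists_synchronizing_word {r : Fin M → Fin M → Prop}
    (h : ∀ a b, Relation.ReflTransGen r a b) (m : Fin M) :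
    ∃ W : List (Fin M × Fin M), (∀ p ∈ W, r p.1 p.2) ∧ ∀ a, srcAfter W a = m := by
  suffices H : ∀ T : Finset (Fin M), ∃ W : List (Fin M × Fin M), (∀ p ∈ W, r p.1 p.2) ∧
      ∀ a ∈ T, srcAfter W a = m by
    obtain ⟨W, hW, hT⟩ := H Finset.univ
    exact ⟨W, hW, fun a => hT a (Finset.mem_univ a)⟩
  intro T
  induction T using Finset.induction_on with
  | empty => exact ⟨[], by simp, by simp⟩
  | insert a T _ ih =>
    obtain ⟨W, hW, hT⟩ := ih
    obtain ⟨W', hW', ha, hm⟩ := exists_word_of_reflTransGen (h (srcAfter W a) m)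
    refine ⟨W ++ W', ?_, ?_⟩
    · intro p hp
      exact (List.mem_append.1 hp).elim (hW p) (hW' p)
    · intro b hb
      rw [srcAfter_append]
      rcases Finset.mem_insert.1 hb with rfl | hb
      · exact ha
      · rw [hT b hb, hm]

end Synchronization

/-! ### Resetting the network, and symmetry under renaming nodes. -/

namespace NetState

variable {n M : ℕ}

attribute [ext] NetState

/-- The state in which the source and all nodes hold `m`, freshly. -/
def allFresh (n : ℕ) (m : Fin M) : NetState n M := ⟨m, fun _ => 0, fun _ => m⟩

theorem src_foldl_sourceMove (W : List (Fin M × Fin M)) (x : NetState n M) :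
    ((W.map Sum.inl).foldl (fun y (e : NetEvent n M) => e.apply y) x).src = srcAfter W x.src := by
  induction W generalizing x with
  | nil => rfl
  | cons p W ih =>
    rw [List.map_cons, List.foldl_cons, ih]
    simp only [NetEvent.apply, sourceMove, srcAfter, List.foldl_cons]
    split_ifs <;> rfl

theorem foldl_push (l : List (Fin n)) (x : NetState n M) :
    (l.map fun j => Sum.inr (Sum.inl j)).foldl (fun y (e : NetEvent n M) => e.apply y) x =
      ⟨x.src, fun i => if i ∈ l then 0 else x.age i,
        fun i => if i ∈ l then x.src else x.content i⟩ := by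
  induction l generalizing x with
  | nil => simp
  | cons j l ih =>
    rw [List.map_cons, List.foldl_cons, ih]
    refine NetState.ext rfl (funext fun i => ?_) (funext fun i => ?_)
    all_goals
      by_cases h1 : i ∈ l <;> by_cases h2 : i = j <;>
        simp [NetEvent.apply, push, h1, h2]

/-- Some word of possible events resets the network to the all-fresh state. -/
theorem exists_reset_word [NeZero n] {q : Matrix (Fin M) (Fin M) ℝ}
    (hq : IsIrreducibleGenerator q) {lam ls : ℝ} (hlam : 0 ≤ lam) (hs : 0 < ls) (m : Fin M) :
    ∃ W : List (NetEvent n M), (∀ e ∈ W, 0 < NetEvent.prob q lam ls e) ∧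
      ∀ x : NetState n M, W.foldl (fun y e => e.apply y) x = allFresh n m := by
  have hn : (0 : ℝ) < n := by exact_mod_cast Nat.pos_of_ne_zero (NeZero.ne n)
  obtain ⟨W, hW, hm⟩ := exists_synchronizing_word hq.irreducible m
  -- Synchronize the source first, then push to every node: this overwrites all ages and contents.
  refine ⟨W.map Sum.inl ++ (List.finRange n).map fun j => Sum.inr (Sum.inl j), ?_, ?_⟩
  · intro e he
    refine div_pos ?_ (NetEvent.sum_rate_pos hq hlam hs)
    rcases List.mem_append.1 he with he | he
    · obtain ⟨⟨a, b⟩, hp, rfl⟩ := List.mem_map.1 he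
      simpa [NetEvent.rate, (hW _ hp).1] using (hW _ hp).2
    · obtain ⟨j, -, rfl⟩ := List.mem_map.1 he
      exact div_pos hs hn
  · intro x
    rw [List.foldl_append, foldl_push, src_foldl_sourceMove, hm]
    simp [allFresh]

/-- Renaming of the nodes. -/
def relabel (σ : Equiv.Perm (Fin n)) (x : NetState n M) : NetState n M :=
  ⟨x.src, x.age ∘ σ, x.content ∘ σ⟩

theorem setAge_relabel (σ : Equiv.Perm (Fin n)) (x : NetState n M) (A : Finset (Fin n)) :
    (x.relabel σ).setAge A = x.setAge (A.map σ.toEmbedding) := by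
  simp [setAge, relabel, Set.image_comp]

theorem acc_relabel (σ : Equiv.Perm (Fin n)) (x : NetState n M) (i : Fin n) :
    (x.relabel σ).acc i = x.acc (σ i) := rfl

theorem setAcc_relabel (σ : Equiv.Perm (Fin n)) (x : NetState n M) (A : Finset (Fin n)) :
    (x.relabel σ).setAcc A = x.setAcc (A.map σ.toEmbedding) := by
  simp [setAcc, acc_relabel]

theorem freshAccFraction_relabel (σ : Equiv.Perm (Fin n)) (x : NetState n M)
    (A : Finset (Fin n)) :
    (x.relabel σ).freshAccFraction A = x.freshAccFraction (A.map σ.toEmbedding) := by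
  simp only [freshAccFraction, acc_relabel, Finset.sum_map, Finset.card_map]
  rfl

end NetState

namespace NetEvent

variable {n M : ℕ} {q : Matrix (Fin M) (Fin M) ℝ} {lam ls : ℝ}

/-- Renaming of the nodes in an event. -/
def relabel (σ : Equiv.Perm (Fin n)) : NetEvent n M ≃ NetEvent n M :=
  Equiv.sumCongr (Equiv.refl _) (Equiv.sumCongr σ (Equiv.prodCongr σ σ))

theorem rate_relabel (σ : Equiv.Perm (Fin n)) (e : NetEvent n M) :
    rate q lam ls (relabel σ e) = rate q lam ls e := by
  rcases e with ⟨a, b⟩ | j | ⟨i, j⟩ <;> simp [relabel, rate]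

/-- Node `j` of the renamed state is node `σ j` of the original, so the event must be renamed by `σ`
as well. -/
theorem apply_relabel (σ : Equiv.Perm (Fin n)) (e : NetEvent n M) (x : NetState n M) :
    e.apply (x.relabel σ) = ((relabel σ e).apply x).relabel σ := by
  rcases e with ⟨a, b⟩ | j | ⟨i, j⟩
  · by_cases h : x.src = a <;>
      simp [relabel, apply, NetState.sourceMove, NetState.relabel, h, Function.comp_def]
  all_goals
    refine NetState.ext rfl (funext fun l => ?_) (funext fun l => ?_)
    all_goals
      by_cases h : l = j <;>
        simp [relabel, apply, NetState.push, NetState.gossip, NetState.relabel, h] <;> rfl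

/-- Renaming permutes the events and preserves their rates, so it commutes with the Markov operator.
-/
theorem avgStep_iterate_relabel (σ : Equiv.Perm (Fin n)) (f : NetState n M → ℝ) (N : ℕ) :
    ∀ x, (avgStep (prob q lam ls) apply)^[N] f (x.relabel σ) =
      (avgStep (prob q lam ls) apply)^[N] (fun y => f (y.relabel σ)) x := by
  induction N with
  | zero => intro x; rfl
  | succ N ih =>
    intro x
    rw [Function.iterate_succ_apply', Function.iterate_succ_apply', avgStep]
    refine (Finset.sum_congr rfl fun e _ => ?_).trans ((relabel σ).sum_comp _)
    rw [apply_relabel, ih, prob, prob, rate_relabel]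

end NetEvent

/-! ### From the embedded chain to continuous time. -/

section SteadyState

variable {n M : ℕ} [NeZero n] {q : Matrix (Fin M) (Fin M) ℝ} {lam ls : ℝ}

theorem integral_lawAfter (hq : IsIrreducibleGenerator q) (hlam : 0 ≤ lam) (hs : 0 < ls)
    (init : PMF (NetState n M)) (N : ℕ) {f : NetState n M → ℝ}
    (hf : ∀ x, f x ∈ Set.Icc (0 : ℝ) 1) :
    ∫ x, f x ∂(lawAfter q lam hs init N).toMeasure =
      ∫ x, (avgStep (NetEvent.prob q lam ls) NetEvent.apply)^[N] f x ∂init.toMeasure := by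
  induction N generalizing f with
  | zero => rfl
  | succ N ih =>
    let _ : MeasurableSpace (NetEvent n M) := ⊤
    have _ : DiscreteMeasurableSpace (NetEvent n M) := ⟨fun _ => trivial⟩
    rw [lawAfter, PMF.integral_bind _ _ hf, Function.iterate_succ_apply,
      ← ih (f := avgStep (NetEvent.prob q lam ls) NetEvent.apply f) (avgStep_iterate_mem_Icc
        (NetEvent.prob_nonneg hq hlam hs) (NetEvent.sum_prob hq hlam hs) hf 1)]
    refine integral_congr_ae (Eventually.of_forall fun x => ?_)
    simp only
    rw [← PMF.toMeasure_map _ _ Measurable.of_discrete,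
      integral_map Measurable.of_discrete.aemeasurable
        Measurable.of_discrete.aestronglyMeasurable, PMF.integral_eq_sum]
    simp [avgStep, NetEvent.law_toReal hq hlam hs]

/-- Uniform convergence along the embedded chain gives the steady-state mean. -/
theorem isSteadyStateMean_of_iterate (hq : IsIrreducibleGenerator q) (hlam : 0 ≤ lam)
    (hs : 0 < ls) {f : NetState n M → ℝ} (hf : ∀ x, f x ∈ Set.Icc (0 : ℝ) 1) {v : ℝ}
    (hv : ∀ ε > 0, ∃ N₀, ∀ N ≥ N₀, ∀ x,
      |(avgStep (NetEvent.prob q lam ls) NetEvent.apply)^[N] f x - v| ≤ ε) :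
    IsSteadyStateMean q lam hs f v := by
  intro init _
  have hint : ∀ N x, (avgStep (NetEvent.prob q lam ls) NetEvent.apply)^[N] f x ∈
      Set.Icc (0 : ℝ) 1 := avgStep_iterate_mem_Icc (NetEvent.prob_nonneg hq hlam hs)
        (NetEvent.sum_prob hq hlam hs) hf
  have hu : Tendsto (fun N => ∫ x, f x ∂(lawAfter q lam hs init N).toMeasure) atTop (𝓝 v) := by
    rw [Metric.tendsto_atTop]
    intro ε hε
    obtain ⟨N₀, hN₀⟩ := hv (ε / 2) (half_pos hε)
    refine ⟨N₀, fun N hN => ?_⟩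
    -- Uniformity in the starting state lets the estimate be integrated against an arbitrary initial
    -- law.
    have h := init.integral_mem_Icc (a := v - ε / 2) (b := v + ε / 2)
      (f := (avgStep (NetEvent.prob q lam ls) NetEvent.apply)^[N] f) fun x => by
        have := abs_le.1 (hN₀ N hN x)
        constructor <;> linarith
    rw [integral_lawAfter hq hlam hs init N hf, Real.dist_eq, abs_lt]
    constructor <;> linarith [h.1, h.2]
  have hr : Tendsto (fun t : ℝ => Real.toNNReal
      (t * ∑ e : NetEvent n M, NetEvent.rate q lam ls e)) atTop atTop :=
    tendsto_real_toNNReal_atTop.comp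
      (tendsto_id.atTop_mul_const (NetEvent.sum_rate_pos hq hlam hs))
  refine ((tendsto_integral_poissonMeasure
    (fun N => (lawAfter q lam hs init N).integral_mem_Icc hf) hu).comp hr).congr fun t => ?_
  rw [lawAt, PMF.integral_bind _ _ hf, Measure.toPMF_toMeasure]
  rfl

end SteadyState

/-! ### Drift of the freshness indicator. -/

section Freshness

variable {n M : ℕ} {q : Matrix (Fin M) (Fin M) ℝ} {lam ls : ℝ}

open Classical in
/-- The indicator that some node has version age zero. -/
noncomputable def NetState.someFresh (x : NetState n M) : ℝ := if ∃ i, x.age i = 0 then 1 else 0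

theorem NetState.someFresh_mem_Icc (x : NetState n M) : x.someFresh ∈ Set.Icc (0 : ℝ) 1 := by
  unfold someFresh
  split_ifs <;> simp

theorem NetState.someFresh_eq_zero {x : NetState n M} (h : ∀ i, x.age i ≠ 0) :
    x.someFresh = 0 := if_neg (by simpa using h)

theorem NetState.someFresh_eq_one {x : NetState n M} {i : Fin n} (h : x.age i = 0) :
    x.someFresh = 1 := if_pos ⟨i, h⟩

theorem NetState.someFresh_mono {x y : NetState n M}
    (h : ∀ i, x.age i = 0 → ∃ j, y.age j = 0) : x.someFresh ≤ y.someFresh := by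
  by_cases hx : ∃ i, x.age i = 0
  · obtain ⟨i, hi⟩ := hx
    obtain ⟨j, hj⟩ := h i hi
    rw [someFresh_eq_one hi, someFresh_eq_one hj]
  · rw [someFresh_eq_zero (by simpa using hx)]
    exact y.someFresh_mem_Icc.1

/-- The rates of leaving the states of the source are bounded below. -/
theorem exists_exit_rate_pos (hM : 2 ≤ M) (hq : IsIrreducibleGenerator q) :
    ∃ ρ > 0, ∀ a : Fin M, ρ ≤ ∑ b, if a = b then 0 else q a b := by
  have _ : Nontrivial (Fin M) := Fin.nontrivial_iff_two_le.2 hM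
  obtain ⟨a₀, h₀⟩ := Finite.exists_min fun a : Fin M => ∑ b, if a = b then 0 else q a b
  refine ⟨_, ?_, h₀⟩
  obtain ⟨c, hc⟩ := exists_ne a₀
  -- A path from the minimizing state to a different state starts with a positive-rate move.
  rcases (hq.irreducible a₀ c).cases_head with h | ⟨b, ⟨hab, hpos⟩, -⟩
  · exact absurd h.symm hc
  · refine Finset.sum_pos' (fun b _ => ?_) ⟨b, Finset.mem_univ b, by simpa [hab] using hpos⟩
    split_ifs with h
    exacts [le_rfl, hq.rate_nonneg _ _ h]

/-- Freshness is created at rate `ls` and destroyed by every move of the source. -/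
theorem avgStep_someFresh_le [NeZero n] (hq : IsIrreducibleGenerator q) (hlam : 0 ≤ lam)
    (hs : 0 < ls) (x : NetState n M) :
    avgStep (NetEvent.prob q lam ls) NetEvent.apply NetState.someFresh x ≤ x.someFresh +
      (ls - (∑ b, if x.src = b then 0 else q x.src b) * x.someFresh) /
        ∑ e : NetEvent n M, NetEvent.rate q lam ls e := by
  have hn : (n : ℝ) ≠ 0 := by exact_mod_cast NeZero.ne n
  -- Change caused by each event: a move out of the current source state removes all freshness, a
  -- push adds at most `1`, and gossip adds nothing because a minimum of two ages is zero only if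
  -- one of them is.
  have hev : ∀ e : NetEvent n M, (e.apply x).someFresh ≤ x.someFresh +
      Sum.elim (fun p => if p.1 = x.src then -x.someFresh else 0)
        (Sum.elim (fun _ => 1) fun _ => 0) e := by
    rintro (⟨a, b⟩ | j | ⟨i, j⟩)
    · by_cases h : x.src = a
      · simp only [NetEvent.apply, NetState.sourceMove, h, if_true, Sum.elim_inl, add_neg_cancel]
        exact (NetState.someFresh_eq_zero fun i => Nat.succ_ne_zero _).le
      · simp [NetEvent.apply, NetState.sourceMove, h, Ne.symm h]
    · have h1 := (NetEvent.apply (.inr (.inl j)) x).someFresh_mem_Icc.2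
      have h2 := x.someFresh_mem_Icc.1
      simp only [Sum.elim_inr, Sum.elim_inl]
      linarith
    · simp only [Sum.elim_inr, add_zero]
      refine NetState.someFresh_mono fun l hl => ?_
      by_cases h : l = j
      · subst h
        simp only [NetEvent.apply, NetState.gossip, Function.update_self] at hl
        rcases min_choice (x.age i) (x.age l) with h | h
        · exact ⟨i, h ▸ hl⟩
        · exact ⟨l, h ▸ hl⟩
      · exact ⟨l, by simpa [NetEvent.apply, NetState.gossip, h] using hl⟩
  refine (Finset.sum_le_sum fun e _ => mul_le_mul_of_nonneg_left (hev e)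
    (NetEvent.prob_nonneg hq hlam hs e)).trans (le_of_eq ?_)
  simp only [mul_add, Finset.sum_add_distrib, ← Finset.sum_mul, NetEvent.sum_prob hq hlam hs,
    one_mul]
  congr 1
  simp only [NetEvent.prob, div_mul_eq_mul_div, ← Finset.sum_div]
  congr 1
  -- After the sums are exchanged, only moves starting at `x.src` survive; the `n` pushes of rate
  -- `ls / n` add up to `ls`.
  rw [Fintype.sum_sum_type, Fintype.sum_sum_type, Fintype.sum_prod_type, Finset.sum_comm]
  simp only [NetEvent.rate, Sum.elim_inl, Sum.elim_inr, mul_ite, mul_zero, mul_one,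
    Finset.sum_ite_eq', Finset.sum_const_zero, add_zero, Finset.mem_univ, if_true]
  rw [Finset.sum_const, Finset.card_univ, Fintype.card_fin, nsmul_eq_mul, mul_div_cancel₀ _ hn,
    Finset.sum_mul, sub_eq_neg_add, ← Finset.sum_neg_distrib]
  simp

/-- Freshness appears at rate at most `ls` and disappears at rate at least `ρ`, so its long-run mean
is at most the ratio. -/
theorem le_of_le_someFresh [NeZero n] (hM : 2 ≤ M) (hq : IsIrreducibleGenerator q)
    (hlam : 0 ≤ lam) (hs : 0 < ls) {ρ : ℝ} (hρ : 0 < ρ)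
    (hexit : ∀ a : Fin M, ρ ≤ ∑ b, if a = b then 0 else q a b) {f : NetState n M → ℝ}
    (hf : ∀ x, f x ≤ x.someFresh) {v : ℝ}
    (hv : ∀ ε > 0, ∃ N₀, ∀ N ≥ N₀, ∀ x,
      |(avgStep (NetEvent.prob q lam ls) NetEvent.apply)^[N] f x - v| ≤ ε) :
    v ≤ ls / ρ := by
  set Λ := ∑ e : NetEvent n M, NetEvent.rate q lam ls e with hΛ
  have hΛ0 : 0 < Λ := NetEvent.sum_rate_pos hq hlam hs
  let m : Fin M := ⟨0, by omega⟩
  have hρΛ : ρ ≤ Λ := by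
    refine (hexit m).trans ?_
    rw [hΛ, Fintype.sum_sum_type, Fintype.sum_prod_type]
    have h1 : (∑ b, if m = b then 0 else q m b) ≤
        ∑ a, ∑ b, NetEvent.rate (n := n) q lam ls (.inl (a, b)) :=
      Finset.single_le_sum (f := fun a => ∑ b, NetEvent.rate (n := n) q lam ls (.inl (a, b)))
        (fun a _ => Finset.sum_nonneg fun b _ => NetEvent.rate_nonneg hq hlam hs _)
        (Finset.mem_univ m)
    exact h1.trans (le_add_of_nonneg_right
      (Finset.sum_nonneg fun e _ => NetEvent.rate_nonneg hq hlam hs _))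
  have hβ : 0 ≤ 1 - ρ / Λ := sub_nonneg.2 ((div_le_one hΛ0).2 hρΛ)
  -- Drift with factor `β = 1 - ρ / Λ` and level `K = ls / ρ`, chosen so that `K * (1 - β) = ls /
  -- Λ`.
  have hd : ∀ x : NetState n M,
      avgStep (NetEvent.prob q lam ls) NetEvent.apply NetState.someFresh x ≤
        ls / ρ * (1 - (1 - ρ / Λ)) + (1 - ρ / Λ) * x.someFresh := by
    intro x
    refine (avgStep_someFresh_le hq hlam hs x).trans ?_
    have h1 := mul_le_mul_of_nonneg_right (hexit x.src) x.someFresh_mem_Icc.1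
    have h2 := div_le_div_of_nonneg_right (sub_le_sub_left h1 ls) hΛ0.le
    refine (add_le_add_right h2 _).trans (le_of_eq ?_)
    field_simp
    ring
  refine le_of_forall_pos_le_add fun ε hε => ?_
  obtain ⟨N, hN⟩ := hv ε hε
  -- A start with no fresh node kills the term `β ^ N * h y`, leaving the bound `K` for every `N`.
  let y : NetState n M := ⟨m, fun _ => 1, fun _ => m⟩
  have h1 := (abs_le.1 (hN N le_rfl y)).1
  have h2 := avgStep_iterate_mono (act := NetEvent.apply) (NetEvent.prob_nonneg hq hlam hs) hf N y
  have h3 := avgStep_iterate_le_of_drift (NetEvent.prob_nonneg hq hlam hs)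
    (NetEvent.sum_prob hq hlam hs) hβ hd N y
  rw [NetState.someFresh_eq_zero (x := y) fun _ => one_ne_zero] at h3
  have h4 : ls / ρ * (1 - (1 - ρ / Λ) ^ N) ≤ ls / ρ :=
    mul_le_of_le_one_right (by positivity) (by linarith [pow_nonneg hβ N])
  linarith

end Freshness

theorem exists_perm_map_eq {n : ℕ} {A B : Finset (Fin n)} (h : A.card = B.card) :
    ∃ σ : Equiv.Perm (Fin n), A.map σ.toEmbedding = B := by
  let e : {x // x ∈ A} ≃ {x // x ∈ B} := Finset.equivOfCardEq h
  refine ⟨e.extendSubtype, Finset.eq_of_subset_of_card_le ?_ (by simp [h])⟩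
  intro x hx
  obtain ⟨a, ha, rfl⟩ := Finset.mem_map.1 hx
  exact e.extendSubtype_mem a ha

/-! ### Observables indexed by sets of nodes. -/

section Families

variable {n M : ℕ} [NeZero n] {q : Matrix (Fin M) (Fin M) ℝ} {lam : ℝ}

/-- Steady-state means of a family of observables indexed by sets of nodes which is compatible
with renaming of the nodes: they exist, depend only on the size of the set, and vanish as
`ls → 0⁺` when the observables require a fresh node. -/
theorem exists_steadyStateMean (hM : 2 ≤ M) (hq : IsIrreducibleGenerator q) (hlam : 0 ≤ lam)
    {k : ℕ} (F : Finset (Fin n) → NetState n M → ℝ)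
    (hF : ∀ A x, A.card = k → F A x ∈ Set.Icc (0 : ℝ) 1)
    (hrel : ∀ A x (σ : Equiv.Perm (Fin n)), F A (x.relabel σ) = F (A.map σ.toEmbedding) x)
    (hkn : k ≤ n) :
    ∃ v : ℝ → ℝ,
      (∀ (ls : ℝ) (hs : 0 < ls) (A : Finset (Fin n)), A.card = k →
        IsSteadyStateMean q lam hs (F A) (v ls)) ∧
      (∀ ls, 0 < ls → v ls ∈ Set.Icc (0 : ℝ) 1) ∧
      ((∀ A x, A.card = k → F A x ≤ x.someFresh) → Tendsto v (𝓝[>] 0) (𝓝 0)) := by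
  obtain ⟨A₀, -, hA₀⟩ := Finset.exists_subset_card_eq (s := (Finset.univ : Finset (Fin n)))
    (n := k) (by simpa using hkn)
  let m : Fin M := ⟨0, by omega⟩
  have hex : ∀ ls : ℝ, 0 < ls → ∃ v, ∀ ε > 0, ∃ N₀, ∀ N ≥ N₀, ∀ x,
      |(avgStep (NetEvent.prob q lam ls) NetEvent.apply)^[N] (F A₀) x - v| ≤ ε := by
    intro ls hs
    obtain ⟨W, hW, hreset⟩ := NetState.exists_reset_word (n := n) hq hlam hs m
    exact exists_avgStep_iterate_tendsto (NetEvent.prob_nonneg hq hlam hs)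
      (NetEvent.sum_prob hq hlam hs) hW hreset fun x => hF A₀ x hA₀
  choose! v hv using hex
  have hv01 : ∀ ls, 0 < ls → v ls ∈ Set.Icc (0 : ℝ) 1 := by
    intro ls hs
    have hb := fun N => avgStep_iterate_mem_Icc (act := NetEvent.apply)
      (NetEvent.prob_nonneg hq hlam hs) (NetEvent.sum_prob hq hlam hs) (fun x => hF A₀ x hA₀) N
      (NetState.allFresh n m)
    constructor <;> refine le_of_forall_pos_le_add fun ε hε => ?_ <;>
      obtain ⟨N, hN⟩ := hv ls hs ε hε <;>
      have h := abs_le.1 (hN N le_rfl (NetState.allFresh n m)) <;>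
      linarith [(hb N).1, (hb N).2]
  refine ⟨v, fun ls hs A hA => ?_, hv01, fun hfresh => ?_⟩
  · refine isSteadyStateMean_of_iterate hq hlam hs (fun x => hF A x hA) fun ε hε => ?_
    obtain ⟨σ, hσ⟩ := exists_perm_map_eq (hA₀.trans hA.symm)
    obtain ⟨N₀, hN₀⟩ := hv ls hs ε hε
    refine ⟨N₀, fun N hN x => ?_⟩
    -- Since the estimate is uniform in the state, evaluating it at the renamed state transfers it
    -- from `A₀` to `A`.
    have h := hN₀ N hN (x.relabel σ)
    rw [NetEvent.avgStep_iterate_relabel] at h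
    simpa only [hrel, hσ] using h
  · obtain ⟨ρ, hρ, hexit⟩ := exists_exit_rate_pos hM hq
    have hlim : Tendsto (fun ls : ℝ => ls / ρ) (𝓝[>] 0) (𝓝 0) := by
      simpa using ((tendsto_id (α := ℝ) (x := 𝓝 0)).div_const ρ).mono_left nhdsWithin_le_nhds
    refine tendsto_of_tendsto_of_tendsto_of_le_of_le' tendsto_const_nhds hlim ?_ ?_
    · filter_upwards [self_mem_nhdsWithin] with ls hs using (hv01 ls hs).1
    · filter_upwards [self_mem_nhdsWithin] with ls hs using
        le_of_le_someFresh hM hq hlam hs hρ hexit (fun x => hfresh A₀ x hA₀) (hv ls hs)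

end Families

/-! ### Comparison of the observables with the freshness indicator, and conclusion. -/

namespace NetState

variable {n M : ℕ}

theorem acc_mem_Icc (x : NetState n M) (i : Fin n) : x.acc i ∈ Set.Icc (0 : ℝ) 1 := by
  unfold acc
  split_ifs <;> simp

theorem average_mem_Icc {A : Finset (Fin n)} (hA : A.Nonempty) {f : Fin n → ℝ} {b : ℝ}
    (hf : ∀ i ∈ A, f i ∈ Set.Icc 0 b) : (∑ i ∈ A, f i) / A.card ∈ Set.Icc 0 b := by
  have hc : (0 : ℝ) < A.card := by exact_mod_cast hA.card_pos
  refine ⟨div_nonneg (Finset.sum_nonneg fun i hi => (hf i hi).1) hc.le, ?_⟩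
  rw [div_le_iff₀ hc, mul_comm, ← nsmul_eq_mul]
  exact Finset.sum_le_card_nsmul _ _ _ fun i hi => (hf i hi).2

theorem setAcc_mem_Icc (x : NetState n M) {A : Finset (Fin n)} (hA : A.Nonempty) :
    x.setAcc A ∈ Set.Icc (0 : ℝ) 1 :=
  average_mem_Icc hA fun i _ => x.acc_mem_Icc i

theorem freshAccFraction_mem_Icc (x : NetState n M) {A : Finset (Fin n)} (hA : A.Nonempty) :
    x.freshAccFraction A ∈ Set.Icc 0 x.someFresh := by
  refine average_mem_Icc hA fun i _ => ?_
  split_ifs with h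
  · rw [someFresh_eq_one h]
    exact x.acc_mem_Icc i
  · exact ⟨le_rfl, x.someFresh_mem_Icc.1⟩

theorem someFresh_eq_one_of_setAge {x : NetState n M} {A : Finset (Fin n)} (hA : A.Nonempty)
    (h : x.setAge A = 0) : x.someFresh = 1 := by
  -- Nonemptiness is essential: the infimum of the empty set is `0` by convention, with no node
  -- attaining it.
  obtain ⟨i, -, hi⟩ : x.setAge A ∈ x.age '' (A : Set (Fin n)) :=
    Nat.sInf_mem (Set.Nonempty.image _ hA)
  exact someFresh_eq_one (hi.trans h)

end NetState

/-- `g ls m` is `g_k^(m) = lim E[1{Q = m, X_A = 0}]`, `c ls m` is `c_k^(m) = lim E[C_A 1{Q = m}]`,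
for every set `A` of `k` nodes, `∑ m, c ls m * g ls m` is `G_k`, `p ls` is the steady-state
probability that some node of `A` is fresh and accurate (the freshest node of `A` is accurate and
has version age zero), and `r ls` is the steady-state expected fraction of the nodes of `A` that
are fresh and accurate. -/
theorem mainTheorem10 {n M : ℕ} [NeZero n] (hM : 2 ≤ M)
    (q : Matrix (Fin M) (Fin M) ℝ) (hq : IsIrreducibleGenerator q)
    (lam : ℝ) (hlam : 0 ≤ lam) (k : ℕ) (hk1 : 1 ≤ k) (hkn : k ≤ n) :
    ∃ (g c : ℝ → Fin M → ℝ) (p r : ℝ → ℝ),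
      (∀ (ls : ℝ) (hs : 0 < ls) (A : Finset (Fin n)), A.card = k →
        (∀ m : Fin M,
          IsSteadyStateMean q lam hs
            (fun x : NetState n M => if x.src = m ∧ x.setAge A = 0 then 1 else 0) (g ls m) ∧
          IsSteadyStateMean q lam hs
            (fun x : NetState n M => if x.src = m then x.setAcc A else 0) (c ls m)) ∧
        IsSteadyStateMean q lam hs
          (fun x : NetState n M =>
            if ∃ i ∈ A, x.age i = x.setAge A ∧ x.content i = x.src ∧ x.setAge A = 0
              then 1 else 0) (p ls) ∧
        IsSteadyStateMean q lam hs
          (fun x : NetState n M => x.freshAccFraction A) (r ls)) ∧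
      (∀ m : Fin M, Tendsto (fun ls => g ls m) (𝓝[>] 0) (𝓝 0)) ∧
      Tendsto (fun ls => ∑ m : Fin M, c ls m * g ls m) (𝓝[>] 0) (𝓝 0) ∧
      Tendsto p (𝓝[>] 0) (𝓝 0) ∧
      Tendsto r (𝓝[>] 0) (𝓝 0) := by
  have hne : ∀ {A : Finset (Fin n)}, A.card = k → A.Nonempty := fun hA =>
    Finset.card_pos.1 (hA ▸ hk1)
  have hg := fun m : Fin M => exists_steadyStateMean hM hq hlam (k := k)
    (fun A (x : NetState n M) => if x.src = m ∧ x.setAge A = 0 then (1 : ℝ) else 0)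
    (fun A x _ => by split_ifs <;> simp)
    (fun A x σ => by simp only [NetState.setAge_relabel]; rfl) hkn
  have hc := fun m : Fin M => exists_steadyStateMean hM hq hlam (k := k)
    (fun A (x : NetState n M) => if x.src = m then x.setAcc A else 0)
    (fun A x hA => by
      split_ifs
      exacts [x.setAcc_mem_Icc (hne hA), by simp])
    (fun A x σ => by simp only [NetState.setAcc_relabel]; rfl) hkn
  have hp := exists_steadyStateMean hM hq hlam (k := k)
    (fun A (x : NetState n M) =>
      if ∃ i ∈ A, x.age i = x.setAge A ∧ x.content i = x.src ∧ x.setAge A = 0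
        then (1 : ℝ) else 0)
    (fun A x _ => by split_ifs <;> simp)
    (fun A x σ => by
      simp only [NetState.setAge_relabel, Finset.mem_map, exists_exists_and_eq_and]
      rfl) hkn
  have hr := exists_steadyStateMean hM hq hlam (k := k)
    (fun A (x : NetState n M) => x.freshAccFraction A)
    (fun A x hA => ⟨(x.freshAccFraction_mem_Icc (hne hA)).1,
      (x.freshAccFraction_mem_Icc (hne hA)).2.trans x.someFresh_mem_Icc.2⟩)
    (fun A x σ => x.freshAccFraction_relabel σ A) hkn
  choose g hg1 hg2 hg3 using hg
  choose c hc1 hc2 _ using hc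
  obtain ⟨p, hp1, -, hp3⟩ := hp
  obtain ⟨r, hr1, -, hr3⟩ := hr
  have hg0 : ∀ m, Tendsto (g m) (𝓝[>] 0) (𝓝 0) := by
    refine fun m => hg3 m fun A x hA => ?_
    split_ifs with h
    · exact (NetState.someFresh_eq_one_of_setAge (hne hA) h.2).ge
    · exact x.someFresh_mem_Icc.1
  refine ⟨fun ls m => g m ls, fun ls m => c m ls, p, r, fun ls hs A hA =>
    ⟨fun m => ⟨hg1 m ls hs A hA, hc1 m ls hs A hA⟩, hp1 ls hs A hA, hr1 ls hs A hA⟩, hg0, ?_,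
    hp3 fun A x hA => ?_, hr3 fun A x hA => (x.freshAccFraction_mem_Icc (hne hA)).2⟩
  -- Each product is squeezed between `0` and `g m ls`, since `c m ls` lies in the unit interval.
  · have h : ∀ m ∈ (Finset.univ : Finset (Fin M)),
        Tendsto (fun ls => c m ls * g m ls) (𝓝[>] 0) (𝓝 0) := by
      refine fun m _ => squeeze_zero' ?_ ?_ (hg0 m)
      · filter_upwards [self_mem_nhdsWithin] with ls hs using
          mul_nonneg (hc2 m ls hs).1 (hg2 m ls hs).1
      · filter_upwards [self_mem_nhdsWithin] with ls hs using
          mul_le_of_le_one_left (hg2 m ls hs).1 (hc2 m ls hs).2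
    simpa using tendsto_finsetSum _ h
  · split_ifs with h
    · obtain ⟨i, -, -, -, h0⟩ := h
      exact (NetState.someFresh_eq_one_of_setAge (hne hA) h0).ge
    · exact x.someFresh_mem_Icc.1
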